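/- Let $(\mathbb{B},\|\cdot\|)$ be a separable real Banach space that is $\beta$-smooth for some $\beta>0$, i.e. $\|x+y\|^2+\|x-y\|^2\le 2\|x\|^2+2\beta^2\|y\|^2$ for all $x,y\in\mathbb{B}$. Let $p\in(1,2]$, $v>0$, and let $(X_n)_{n\ge1}$ be integrable $\mathbb{B}$-valued random variables adapted to a filtration $(\mathcal{F}_n)_{n\ge0}$ such that, for some $\mu\in\mathbb{B}$ and all $n\ge1$, almost surely $$\mathbb{E}(X_n\mid\mathcal{F}_{n-1})=\mu,\qquad \mathbb{E}(\|X_n\|^p\mid\mathcal{F}_{n-1})\le v .$$ For $\lambda>0$ put $$\widehat\mu_n(0,\lambda,0)=\frac1n\sum_{m=1}^n \mathtt{Trunc}(\lambda X_m)X_m,\qquad \mathtt{Trunc}(x)=\frac{\min(1,\|x\|)}{\|x\|}\ (x\neq0),\quad \mathtt{Trunc}(0)=1,$$ and set $$K_p=\frac1p\Big(\frac{p-1}{p}\Big)^{p-1},\qquad \mathfrak{C}_p(\mathbb{B})=c\,\frac{e^{2/\beta}-2/\beta-1}{(2/\beta)^2},$$ where $c=2^{p-1}$ if $\mathbb{B}$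 is a Hilbert space (its norm is induced by an inner product) and $c=2^{p+1}$ otherwise. Fix $\delta\in(0,1]$. (a) For every $\lambda>0$, with probability at least $1-\delta$, simultaneously for all $n\ge1$, $$\big\|\widehat\mu_n(0,\lambda,0)-\mu\big\|\le 2v\lambda^{p-1}\big(\beta\mathfrak{C}_p(\mathbb{B})+K_p2^{p-1}\big)+\frac{\beta\log(2/\delta)}{\lambda n}.$$ (b) For every fixed $n\ge1$, if $$\lambda=\left(\frac{\beta\log(2/\delta)}{2nv\,(\beta\mathfrak{C}_p(\mathbb{B})+K_p2^{p-1})}\right)^{1/p},$$ then, with probability at least $1-\delta$, $$\big\|\widehat\mu_n(0,\lambda,0)-\mu\big\|\le 2\big(2v(\beta\mathfrak{C}_p(\mathbb{B})+K_p2^{p-1})\big)^{1/p}\left(\frac{\beta\log(2/\delta)}{n}\right)^{(p-1)/p}.$$ -/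

import Mathlib

open MeasureTheory

/-- `f : B → ℝ` is `(2, β)`-smooth. -/
structure IsTwoSmooth {B : Type*} [NormedAddCommGroup B] (f : B → ℝ) (β : ℝ) : Prop where
  map_zero : f 0 = 0
  lipschitz : ∀ x y : B, |f (x + y) - f x| ≤ ‖y‖
  smooth : ∀ x y : B, f (x + y) ^ 2 + f (x - y) ^ 2 ≤ 2 * f x ^ 2 + 2 * β ^ 2 * ‖y‖ ^ 2

/-- A normed space is `β`-smooth if its norm is `(2, β)`-smooth. The constant `β` is taken positive
(only `β ^ 2` enters the smoothness inequality); then `1 ≤ β` is automatic unless `B = {0}`. -/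
structure IsSmoothSpace (B : Type*) [NormedAddCommGroup B] (β : ℝ) : Prop where
  pos : 0 < β
  norm_smooth : IsTwoSmooth (fun x : B => ‖x‖) β

/-- The norm of `B` is induced by an inner product. For a Banach space this says that it is a
Hilbert space. -/
def NormIsInner (B : Type*) [NormedAddCommGroup B] [NormedSpace ℝ B] : Prop :=
  ∃ ip : B →ₗ[ℝ] B →ₗ[ℝ] ℝ, (∀ x y, ip x y = ip y x) ∧ ∀ x, ip x x = ‖x‖ ^ 2

/-- The truncation weight `Trunc x = (1 ∧ ‖x‖) / ‖x‖`, with `Trunc 0 = 1`. -/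
noncomputable def truncWeight {B : Type*} [NormedAddCommGroup B] (x : B) : ℝ :=
  open Classical in if x = 0 then 1 else min 1 ‖x‖ / ‖x‖

/-- The uncentered truncated mean of `X 1, …, X n` at truncation level `lam`, along a fixed
sample path. -/
noncomputable def truncMean {B : Type*} [NormedAddCommGroup B] [NormedSpace ℝ B]
    (X : ℕ → B) (lam : ℝ) (n : ℕ) : B :=
  (1 / (n : ℝ)) • ∑ m ∈ Finset.Icc 1 n, truncWeight (lam • X m) • X m

/-- `K_p = 1 / (k + 1) * (k / (k + 1)) ^ k` with `k = p / q = p - 1`, where `1 / p + 1 / q = 1`. -/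
noncomputable def truncConst (p : ℝ) : ℝ := 1 / p * ((p - 1) / p) ^ (p - 1)

/-- The constant `ℭ_p(B, ρ)`. -/
noncomputable def spaceConstAt (B : Type*) [NormedAddCommGroup B] [NormedSpace ℝ B]
    (p ρ : ℝ) : ℝ :=
  open Classical in
  if NormIsInner B then
    (2 : ℝ) ^ (p - 1) * ((Real.exp (2 * ρ) - 2 * ρ - 1) / (2 * ρ) ^ 2)
  else
    (2 : ℝ) ^ (p + 1) * ((Real.exp (2 * ρ) - 2 * ρ - 1) / (2 * ρ) ^ 2)

/-- The constant `ℭ_p(B) = ℭ_p(B, β⁻¹)` of a `β`-smooth space. -/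
noncomputable def spaceConst (B : Type*) [NormedAddCommGroup B] [NormedSpace ℝ B]
    (p β : ℝ) : ℝ :=
  spaceConstAt B p β⁻¹

/-- `X 1, X 2, …` is adapted to `ℱ`, has constant conditional mean `mu`, and has conditional raw
`p`-th moment at most `v` (`X 0` plays no role). The integrability fields say that the conditional
expectations exist and that the second one is finite. -/
structure RawMomentProcess {Ω B : Type*} {mΩ : MeasurableSpace Ω} [NormedAddCommGroup B]
    [NormedSpace ℝ B] [CompleteSpace B] (P : Measure Ω) (ℱ : Filtration ℕ mΩ)
    (X : ℕ → Ω → B) (mu : B) (p v : ℝ) : Prop where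
  adapted : ∀ n, 1 ≤ n → StronglyMeasurable[ℱ n] (X n)
  integrable : ∀ n, 1 ≤ n → Integrable (X n) P
  integrable_moment : ∀ n, 1 ≤ n → Integrable (fun ω => ‖X n ω‖ ^ p) P
  cond_mean : ∀ n, 1 ≤ n → ∀ᵐ ω ∂P, (P[X n | ℱ (n - 1)]) ω = mu
  cond_moment : ∀ n, 1 ≤ n → ∀ᵐ ω ∂P, (P[fun ω' => ‖X n ω'‖ ^ p | ℱ (n - 1)]) ω ≤ v

/-! Truncation makes the increments `W n = truncWeight (lam • X) • (lam • X)` bounded by 1, and two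
pointwise bounds by `‖lam • X‖ ^ p` control their second moment and their distance to `lam • X`.
With `M n` the conditional mean of `W n`, the error `lam * n * (truncMean - mu)` is the martingale
`∑ (W - M)` plus the bias `∑ (M - lam • mu)`, which is at most `n * K_p * lam ^ p * v`. The
martingale is handled by Pinelis' method. Smoothness makes `‖·‖ ^ 2` lie below its linearization
plus `2 * β ^ 2 * ‖y‖ ^ 2` (`IsSmoothSpace.exists_gradient`). Hence `cosh (‖x‖ / β)` grows under an
increment `d` by a term linear in `d`, which vanishes in conditional mean, and by at most a multiple
of `cosh (‖x‖ / β) * ‖d‖ ^ 2`. So `exp (-κ n) * cosh (‖S n‖ / β)` is a supermartingale started at 1,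
and Ville's inequality at level `1 / δ` bounds all `n` at once. Part (b) takes the `lam` at which
the two terms of (a) are equal. -/

/-! ### Scalar inequalities for the exponential and hyperbolic functions -/

/-- The third-order remainder of the exponential series is superquadratic. -/
theorem exp_remainder_mul_le {θ T : ℝ} (hθ : 0 ≤ θ) (hθ1 : θ ≤ 1) (hT : 0 ≤ T) :
    Real.exp (θ * T) - 1 - θ * T - (θ * T) ^ 2 / 2 ≤
      θ ^ 2 * (Real.exp T - 1 - T - T ^ 2 / 2) := by
  have key : ∀ x : ℝ, HasSum (fun n : ℕ => x ^ (n + 3) / (Nat.factorial (n + 3) : ℝ))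
      (Real.exp x - 1 - x - x ^ 2 / 2) := by
    intro x
    have h : HasSum (fun n : ℕ => x ^ n / (Nat.factorial n : ℝ)) (Real.exp x) := by
      rw [Real.exp_eq_exp_ℝ]
      exact NormedSpace.expSeries_div_hasSum_exp x
    have h3 := (hasSum_nat_add_iff' 3).mpr h
    have e : ∑ i ∈ Finset.range 3, x ^ i / (Nat.factorial i : ℝ) = 1 + x + x ^ 2 / 2 := by
      norm_num [Finset.sum_range_succ, Nat.factorial]
    rw [e] at h3
    rwa [show Real.exp x - 1 - x - x ^ 2 / 2 = Real.exp x - (1 + x + x ^ 2 / 2) by ring]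
  refine hasSum_le (fun n => ?_) (key (θ * T)) ((key T).mul_left (θ ^ 2))
  rw [← mul_div_assoc, mul_pow]
  have : θ ^ (n + 3) ≤ θ ^ 2 := pow_le_pow_of_le_one hθ hθ1 (by omega)
  gcongr

theorem exp_remainder_nonneg {T : ℝ} (hT : 0 ≤ T) : 0 ≤ Real.exp T - 1 - T - T ^ 2 / 2 := by
  have := Real.quadratic_le_exp_of_nonneg hT
  linarith

theorem exp_remainder_mono {e s : ℝ} (he : 0 ≤ e) (hes : e ≤ s) :
    Real.exp e - 1 - e - e ^ 2 / 2 ≤ Real.exp s - 1 - s - s ^ 2 / 2 := by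
  rcases he.eq_or_lt with rfl | he'
  · simpa using exp_remainder_nonneg hes
  have hs : 0 < s := he'.trans_le hes
  have h := exp_remainder_mul_le (θ := e / s) (by positivity) (div_le_one_of_le₀ hes hs.le) hs.le
  rw [div_mul_cancel₀ _ hs.ne'] at h
  refine h.trans (mul_le_of_le_one_left (exp_remainder_nonneg hs.le) ?_)
  exact pow_le_one₀ (by positivity) (div_le_one_of_le₀ hes hs.le)

theorem sinh_le_mul_cosh {r : ℝ} (hr : 0 ≤ r) : Real.sinh r ≤ r * Real.cosh r := by
  have hmono : MonotoneOn (fun x => x * Real.cosh x - Real.sinh x) (Set.Ici 0) := by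
    refine monotoneOn_of_hasDerivWithinAt_nonneg (f' := fun x => x * Real.sinh x) (convex_Ici 0)
      (by fun_prop) (fun x _ => ?_) (fun x hx => ?_)
    · have := ((hasDerivAt_id x).mul (Real.hasDerivAt_cosh x)).sub (Real.hasDerivAt_sinh x)
      refine (this.congr_deriv ?_).hasDerivWithinAt
      simp
    · rw [interior_Ici] at hx
      exact mul_nonneg (le_of_lt hx) (Real.sinh_nonneg_iff.2 (le_of_lt hx))
  have := hmono (Set.mem_Ici.2 le_rfl) hr hr
  simpa using this

/-- By the addition formula and `sinh r < cosh r`, everything beyond first order in `e` is at most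
`cosh r` times `cosh e - 1 + |sinh e - e|`, which equals `exp |e| - 1 - |e|`. -/
theorem cosh_add_sub_le (r e : ℝ) (hr : 0 ≤ r) :
    Real.cosh (r + e) ≤ Real.cosh r + Real.sinh r * e +
      Real.cosh r * (Real.exp |e| - 1 - |e|) := by
  have h1 : Real.exp |e| = Real.cosh e + |Real.sinh e| := by
    rw [← Real.cosh_abs e, Real.abs_sinh, Real.cosh_add_sinh]
  have h2 : |Real.sinh e| - |e| = |Real.sinh e - e| := by
    rcases le_total 0 e with h | h
    · have := Real.self_le_sinh_iff.2 h
      rw [abs_of_nonneg (h.trans this), abs_of_nonneg h, abs_of_nonneg (by linarith)]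
    · have := Real.sinh_le_self_iff.2 h
      rw [abs_of_nonpos (this.trans h), abs_of_nonpos h, abs_of_nonpos (by linarith)]
      ring
  have h3 : Real.sinh r * (Real.sinh e - e) ≤ Real.cosh r * |Real.sinh e - e| :=
    (mul_le_mul_of_nonneg_left (le_abs_self _) (Real.sinh_nonneg_iff.2 hr)).trans
      (mul_le_mul_of_nonneg_right (Real.sinh_lt_cosh r).le (abs_nonneg _))
  rw [Real.cosh_add]
  have h4 : Real.exp |e| - 1 - |e| = Real.cosh e - 1 + |Real.sinh e - e| := by
    rw [← h2, h1]; ring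
  rw [h4]
  linarith

/-- Used with `r` and `w` the scaled norms before and after an increment: only the squared norm is
known to be smooth, so the bound on `w ^ 2` has to be converted into one on `cosh w`. -/
theorem cosh_le_of_sq_le {r w s G D : ℝ} (hr : 0 ≤ r) (hw : w ^ 2 ≤ r ^ 2 + G + 2 * D)
    (hs : |w - r| ≤ s) (hD : s ^ 2 ≤ D) (hG : r = 0 → G = 0) :
    Real.cosh w ≤ Real.cosh r + Real.sinh r / (2 * r) * G +
      Real.cosh r * (D + (Real.exp s - 1 - s - s ^ 2 / 2)) := by
  have h1 := cosh_add_sub_le r (w - r) hr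
  rw [add_sub_cancel] at h1
  have h2 := exp_remainder_mono (abs_nonneg (w - r)) hs
  rw [sq_abs] at h2
  have hsq : (w - r) ^ 2 ≤ D := by
    refine le_trans ?_ hD
    rw [← sq_abs]
    gcongr
  have h3 : Real.sinh r * (w - r) ≤
      Real.sinh r / (2 * r) * G + Real.cosh r * (D - (w - r) ^ 2 / 2) := by
    -- At `r = 0` the coefficient `sinh r / (2 * r)` is `0` by the convention for division, and the
    -- linear term drops out.
    rcases hr.eq_or_lt with rfl | hr'
    · simp
      simp at hsq
      nlinarith [sq_nonneg w]
    have hq : 0 ≤ Real.sinh r / (2 * r) :=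
      div_nonneg (Real.sinh_nonneg_iff.2 hr) (by positivity)
    have h5 : Real.sinh r / (2 * r) * 2 ≤ Real.cosh r := by
      rw [div_mul_eq_mul_div, div_le_iff₀ (by positivity)]
      linarith [sinh_le_mul_cosh hr]
    have h6 : Real.sinh r * (w - r) = Real.sinh r / (2 * r) * (2 * r * (w - r)) := by
      field_simp
    -- From `2 * r * (w - r) = w ^ 2 - r ^ 2 - (w - r) ^ 2`. The term `-(w - r) ^ 2` is kept: it
    -- cancels the quadratic term of the exponential, leaving only the third-order remainder.
    have h7 : 2 * r * (w - r) ≤ G + 2 * (D - (w - r) ^ 2 / 2) := by nlinarith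
    rw [h6]
    have h8 := mul_le_mul_of_nonneg_left h7 hq
    have h9 := mul_le_mul_of_nonneg_right h5
      (show 0 ≤ D - (w - r) ^ 2 / 2 by nlinarith [sq_nonneg (w - r)])
    linarith
  have h4 := mul_le_mul_of_nonneg_left h2 (Real.cosh_pos r).le
  linarith

/-- `(e ^ T - T - 1) / T ^ 2`, evaluated at `T = 2 * ρ`. -/
noncomputable def expQuotient (ρ : ℝ) : ℝ := (Real.exp (2 * ρ) - 2 * ρ - 1) / (2 * ρ) ^ 2

theorem half_le_expQuotient {ρ : ℝ} (hρ : 0 < ρ) : 1 / 2 ≤ expQuotient ρ := by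
  rw [expQuotient, le_div_iff₀ (by positivity)]
  have := Real.quadratic_le_exp_of_nonneg (x := 2 * ρ) (by positivity)
  linarith

/-- Scaling the remainder from `2 * ρ` down to `t * ρ` gives `(t * ρ) ^ 2 * (expQuotient ρ - 1 /
2)`. The sum is then at most `(expQuotient ρ + 1 / 2) * t ^ 2`, and `1 / 2 ≤ expQuotient ρ`. -/
theorem add_exp_remainder_le {ρ t : ℝ} (hρ : 0 < ρ) (ht : 0 ≤ t) (ht2 : t ≤ 2)
    (h : (t * ρ) ^ 2 ≤ t ^ 2) :
    t ^ 2 + (Real.exp (t * ρ) - 1 - t * ρ - (t * ρ) ^ 2 / 2) ≤ 2 * expQuotient ρ * t ^ 2 := by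
  have h1 := exp_remainder_mul_le (θ := t / 2) (T := 2 * ρ) (by positivity) (by linarith)
    (by positivity)
  have e1 : t / 2 * (2 * ρ) = t * ρ := by ring
  rw [e1] at h1
  have h2 : (t / 2) ^ 2 * (Real.exp (2 * ρ) - 1 - 2 * ρ - (2 * ρ) ^ 2 / 2) =
      (t * ρ) ^ 2 * (expQuotient ρ - 1 / 2) := by
    rw [expQuotient]; field_simp; ring
  have h3 := mul_le_mul_of_nonneg_right h (sub_nonneg.2 (half_le_expQuotient hρ))
  have h4 := mul_le_mul_of_nonneg_right (half_le_expQuotient hρ) (sq_nonneg t)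
  rw [h2] at h1
  linarith

/-! ### Smooth norms: a gradient of the squared norm and the growth of its hyperbolic cosine -/

section Smooth

variable {B : Type*} [NormedAddCommGroup B] [NormedSpace ℝ B] {β : ℝ}

/-- The square of the norm of a smooth space has a Lipschitz derivative. -/
theorem IsSmoothSpace.exists_gradient (hB : IsSmoothSpace B β) :
    ∃ g : B → StrongDual ℝ B, Continuous g ∧ (∀ x, ‖g x‖ ≤ 2 * ‖x‖) ∧
      ∀ x y, ‖x + y‖ ^ 2 ≤ ‖x‖ ^ 2 + g x y + 2 * β ^ 2 * ‖y‖ ^ 2 := by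
  choose J hJ1 hJx using fun x : B => exists_dual_vector'' ℝ x
  have hJle : ∀ x y, J x y ≤ ‖y‖ := fun x y =>
    (le_abs_self _).trans (((J x).le_opNorm y).trans (mul_le_of_le_one_left (norm_nonneg _) (hJ1 x)))
  -- A subgradient of the squared norm, built from norming functionals. Smoothness at `x, ±y` turns
  -- its lower bound into an upper one; the two together force `g` to be Lipschitz. Continuity is
  -- what later makes `g (S ω)` strongly measurable.
  set g : B → StrongDual ℝ B := fun x => (2 * ‖x‖) • J x with hg
  have hgapp : ∀ x y, g x y = 2 * ‖x‖ * J x y := fun x y => rfl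
  have lower : ∀ x y, ‖x‖ ^ 2 + g x y ≤ ‖x + y‖ ^ 2 := by
    intro x y
    have h1 : ‖x‖ + J x y ≤ ‖x + y‖ := by
      have := hJle x (x + y)
      rw [map_add, hJx] at this
      simpa using this
    rw [hgapp]
    nlinarith [norm_nonneg x, sq_nonneg (‖x + y‖ - ‖x‖)]
  have upper : ∀ x y, ‖x + y‖ ^ 2 ≤ ‖x‖ ^ 2 + g x y + 2 * β ^ 2 * ‖y‖ ^ 2 := by
    intro x y
    have h1 := hB.norm_smooth.smooth x y
    have h2 := lower x (-y)
    rw [← sub_eq_add_neg, map_neg] at h2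
    linarith
  refine ⟨g, ?_, fun x => ?_, upper⟩
  · have lip : LipschitzWith (Real.toNNReal (4 * β ^ 2)) g := by
      refine LipschitzWith.of_dist_le_mul fun x x' => ?_
      rw [Real.coe_toNNReal _ (by positivity), dist_eq_norm, dist_eq_norm]
      rcases eq_or_ne x x' with rfl | hne
      · simp
      have he : 0 < ‖x - x'‖ := norm_pos_iff.2 (sub_ne_zero.2 hne)
      -- The value `‖x' + y‖ ^ 2` is bounded below by linearizing at `x` and above by linearizing at
      -- `x'`. Taking `‖y‖ = ‖x - x'‖` merges the two quadratic errors into one product.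
      have aux : ∀ y, ‖y‖ = ‖x - x'‖ → (g x - g x') y ≤ 4 * β ^ 2 * ‖x - x'‖ * ‖y‖ := by
        intro y hy
        have h1 := lower x (x' + y - x)
        have h2 := upper x' y
        have h3 := upper x (x' - x)
        rw [add_sub_cancel, map_sub, map_add] at h1
        rw [add_sub_cancel, map_sub, norm_sub_rev] at h3
        rw [hy] at h2 ⊢
        rw [sub_apply]
        nlinarith
      refine ContinuousLinearMap.opNorm_le_of_unit_norm (by positivity) fun u hu => ?_
      have hn : ‖‖x - x'‖ • u‖ = ‖x - x'‖ := by rw [norm_smul, norm_norm, hu, mul_one]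
      have h1 := aux (‖x - x'‖ • u) hn
      have h2 := aux (-(‖x - x'‖ • u)) (by rw [norm_neg, hn])
      rw [norm_neg, map_neg] at h2
      rw [hn, map_smul, smul_eq_mul] at h1 h2
      rw [Real.norm_eq_abs, abs_le]
      constructor
      · exact le_of_mul_le_mul_left (by linarith) he
      · exact le_of_mul_le_mul_left (by linarith) he
    exact lip.continuous
  · rw [hg]
    simp only [norm_smul, norm_mul, norm_norm, Real.norm_ofNat]
    exact mul_le_of_le_one_right (by positivity) (hJ1 x)

/-- The hyperbolic cosine of the norm of a smooth space grows at most quadratically, up to a term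
that is linear in the increment. -/
theorem IsSmoothSpace.exists_cosh_norm_add_le (hB : IsSmoothSpace B β) :
    ∃ (c : ℝ → ℝ) (g : B → StrongDual ℝ B), Measurable c ∧ Continuous g ∧
      (∀ x, ‖c ‖x‖ • g x‖ ≤ Real.sinh (‖x‖ / β) / β) ∧
      ∀ x d, ‖d‖ ≤ 2 → Real.cosh (‖x + d‖ / β) ≤ Real.cosh (‖x‖ / β) + (c ‖x‖ • g x) d +
        Real.cosh (‖x‖ / β) * (2 * expQuotient β⁻¹ * ‖d‖ ^ 2) := by
  obtain ⟨g, hgc, hgn, hg⟩ := hB.exists_gradient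
  have hβ := hB.pos
  -- This `c` need not be continuous at `0`, where its value is `0`; measurability suffices.
  refine ⟨fun t => Real.sinh (t / β) / (2 * (t / β)) / β ^ 2, g, by fun_prop, hgc, fun x => ?_,
    fun x d hd => ?_⟩
  · rw [norm_smul, Real.norm_of_nonneg
      (div_nonneg (div_nonneg (Real.sinh_nonneg_iff.2 (by positivity)) (by positivity))
        (by positivity))]
    rcases eq_or_ne x 0 with rfl | hx
    · simp
    have hx' : 0 < ‖x‖ := norm_pos_iff.2 hx
    have hs : 0 ≤ Real.sinh (‖x‖ / β) := Real.sinh_nonneg_iff.2 (by positivity)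
    calc _ ≤ Real.sinh (‖x‖ / β) / (2 * (‖x‖ / β)) / β ^ 2 * (2 * ‖x‖) := by
          gcongr
          exact hgn x
      _ = _ := by field_simp
  -- Smoothness at `x = 0` reads `‖d‖ ^ 2 ≤ β ^ 2 * ‖d‖ ^ 2`, which replaces `1 ≤ β` and covers the
  -- trivial space.
  · have hd2 : (‖d‖ * β⁻¹) ^ 2 ≤ ‖d‖ ^ 2 := by
      have := hB.norm_smooth.smooth 0 d
      simp at this
      rw [mul_pow, inv_pow, ← div_eq_mul_inv, div_le_iff₀ (by positivity)]
      linarith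
    have h1 := cosh_le_of_sq_le (r := ‖x‖ / β) (w := ‖x + d‖ / β) (s := ‖d‖ * β⁻¹)
      (G := g x d / β ^ 2) (D := ‖d‖ ^ 2) (by positivity) ?_ ?_ hd2 ?_
    · refine h1.trans ?_
      have h2 := mul_le_mul_of_nonneg_left
        (add_exp_remainder_le (inv_pos.2 hβ) (norm_nonneg d) hd hd2)
        (Real.cosh_pos (‖x‖ / β)).le
      refine add_le_add (add_le_add le_rfl (le_of_eq ?_)) h2
      simp only [smul_apply, smul_eq_mul]
      ring
    · have := hg x d
      rw [div_pow, div_pow, ← add_div, div_le_iff₀ (by positivity), add_mul,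
        div_mul_cancel₀ _ (by positivity)]
      linarith
    · rw [← sub_div, abs_div, abs_of_pos hβ, div_eq_mul_inv]
      gcongr
      simpa using abs_norm_sub_norm_le (x + d) x
    · intro h
      have hx : x = 0 := by simpa [hβ.ne'] using h
      have := hgn x
      rw [hx, norm_zero, mul_zero, norm_le_zero_iff] at this
      simp [hx, this]

end Smooth

/-! ### Ville's inequality and concentration of smooth-space martingales -/

section Martingale

variable {Ω : Type*} {mΩ : MeasurableSpace Ω} {P : Measure Ω} {ℱ : Filtration ℕ mΩ}

/-- Ville's inequality: the maximal inequality for nonnegative supermartingales. -/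
theorem measure_exists_le_of_supermartingale [IsFiniteMeasure P] {Z : ℕ → Ω → ℝ}
    (hZ : Supermartingale Z ℱ P) (h0 : ∀ n ω, 0 ≤ Z n ω) {a : ℝ} (ha : 0 < a) :
    P {ω | ∃ n, a ≤ Z n ω} ≤ ENNReal.ofReal ((∫ ω, Z 0 ω ∂P) / a) := by
  -- The level is reached strictly before time `n`, so that `E (n + 1)` is still `ℱ n`-measurable
  -- and the supermartingale property applies on its complement.
  set E : ℕ → Set Ω := fun n => {ω | ∃ k < n, a ≤ Z k ω} with hE
  have hEmeas : ∀ n, MeasurableSet[ℱ n] (E n) := by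
    intro n
    have : E n = ⋃ k, ⋃ (_ : k < n), {ω | a ≤ Z k ω} := by
      ext ω; simp [hE]
    rw [this]
    refine MeasurableSet.iUnion fun k => MeasurableSet.iUnion fun hk => ℱ.mono hk.le _ ?_
    exact measurableSet_le measurable_const (hZ.stronglyMeasurable k).measurable
  have hEmeas' : ∀ n, MeasurableSet (E n) := fun n => ℱ.le n _ (hEmeas n)
  have hEsucc : ∀ n, E (n + 1) = E n ∪ ((E n)ᶜ ∩ {ω | a ≤ Z n ω}) := by
    intro n
    ext ω
    simp only [hE, Set.mem_ofPred_eq, Set.mem_union, Set.mem_inter_iff, Set.mem_compl_iff,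
      Nat.lt_succ_iff_lt_or_eq]
    constructor
    · rintro ⟨k, hk | rfl, h⟩
      · exact Or.inl ⟨k, hk, h⟩
      · by_cases h' : ∃ j < k, a ≤ Z j ω
        · exact Or.inl h'
        · exact Or.inr ⟨h', h⟩
    · rintro (⟨k, hk, h⟩ | ⟨-, h⟩)
      · exact ⟨k, Or.inl hk, h⟩
      · exact ⟨n, Or.inr rfl, h⟩
  -- The left side bounds from below the mean of `Z` stopped on reaching `a`: paths in `E n` count
  -- for `a`, the others for `Z n`. It does not increase with `n`.
  have hmain : ∀ n, a * P.real (E n) + ∫ ω in (E n)ᶜ, Z n ω ∂P ≤ ∫ ω, Z 0 ω ∂P := by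
    intro n
    induction n with
    | zero => simp [hE]
    | succ n ih =>
      refine le_trans ?_ ih
      have hF : MeasurableSet ((E n)ᶜ ∩ {ω | a ≤ Z n ω}) :=
        (hEmeas' n).compl.inter (measurableSet_le measurable_const
          ((hZ.stronglyMeasurable n).mono (ℱ.le n)).measurable)
      have hsplit : (E n)ᶜ = ((E n)ᶜ ∩ {ω | a ≤ Z n ω}) ∪ (E (n + 1))ᶜ := by
        rw [hEsucc]
        ext ω
        simp only [Set.mem_union, Set.mem_inter_iff, Set.mem_compl_iff]
        tauto
      have hdisj : Disjoint ((E n)ᶜ ∩ {ω | a ≤ Z n ω}) (E (n + 1))ᶜ := by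
        rw [hEsucc, Set.disjoint_compl_right_iff_subset]
        exact Set.subset_union_right
      have h1 : ∫ ω in (E n)ᶜ, Z n ω ∂P = ∫ ω in (E n)ᶜ ∩ {ω | a ≤ Z n ω}, Z n ω ∂P +
          ∫ ω in (E (n + 1))ᶜ, Z n ω ∂P := by
        conv_lhs => rw [hsplit]
        exact setIntegral_union hdisj (hEmeas' (n + 1)).compl (hZ.integrable n).integrableOn
          (hZ.integrable n).integrableOn
      have h2 : a * P.real ((E n)ᶜ ∩ {ω | a ≤ Z n ω}) ≤
          ∫ ω in (E n)ᶜ ∩ {ω | a ≤ Z n ω}, Z n ω ∂P :=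
        setIntegral_ge_of_const_le_real hF (measure_ne_top _ _) (fun ω hω => hω.2)
          (hZ.integrable n).integrableOn
      have hmeas : MeasurableSet[ℱ n] (E (n + 1)) := by
        rw [hEsucc]
        exact (hEmeas n).union ((hEmeas n).compl.inter
          (measurableSet_le measurable_const (hZ.stronglyMeasurable n).measurable))
      have h3 := hZ.setIntegral_le (Nat.le_succ n) hmeas.compl
      have h4 : P.real (E (n + 1)) = P.real (E n) + P.real ((E n)ᶜ ∩ {ω | a ≤ Z n ω}) := by
        rw [hEsucc]
        exact measureReal_union (disjoint_compl_right.mono_right Set.inter_subset_left) hF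
      rw [h4, h1]
      simp only [Nat.succ_eq_add_one] at h3
      linarith
  have hmono : Monotone E := fun i j hij ω ⟨k, hk, h⟩ => ⟨k, hk.trans_le hij, h⟩
  have hU : {ω | ∃ n, a ≤ Z n ω} = ⋃ n, E n := by
    ext ω
    simp only [hE, Set.mem_ofPred_eq, Set.mem_iUnion]
    exact ⟨fun ⟨n, h⟩ => ⟨n + 1, n, n.lt_succ_self, h⟩, fun ⟨_, k, _, h⟩ => ⟨k, h⟩⟩
  rw [hU, hmono.measure_iUnion]
  refine iSup_le fun n => ?_
  rw [← ofReal_measureReal]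
  refine ENNReal.ofReal_le_ofReal ?_
  rw [le_div_iff₀ ha]
  have := hmain n
  have h5 : 0 ≤ ∫ ω in (E n)ᶜ, Z n ω ∂P := integral_nonneg fun ω => h0 n ω
  linarith

section Sums

variable {B : Type*} [NormedAddCommGroup B] {β : ℝ}

theorem ae_norm_sum_range_le {d : ℕ → Ω → B} (hbdd : ∀ n, ∀ᵐ ω ∂P, ‖d n ω‖ ≤ 2) (n : ℕ) :
    ∀ᵐ ω ∂P, ‖∑ i ∈ Finset.range n, d i ω‖ ≤ n * 2 := by
  filter_upwards [ae_all_iff.2 hbdd] with ω hω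
  simpa using norm_sum_le_of_le (Finset.range n) fun i _ => hω i

theorem stronglyMeasurable_sum_range {d : ℕ → Ω → B}
    (hd : ∀ n, StronglyMeasurable[ℱ (n + 1)] (d n)) (n : ℕ) :
    StronglyMeasurable[ℱ n] fun ω => ∑ i ∈ Finset.range n, d i ω :=
  Finset.stronglyMeasurable_fun_sum _ fun i hi =>
    (hd i).mono (ℱ.mono (Finset.mem_range.1 hi))

theorem integrable_cosh_norm_div [IsFiniteMeasure P] {f : Ω → B} (hβ : 0 < β)
    (hf : AEStronglyMeasurable f P) {R : ℝ} (hR : ∀ᵐ ω ∂P, ‖f ω‖ ≤ R) :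
    Integrable (fun ω => Real.cosh (‖f ω‖ / β)) P := by
  refine Integrable.of_bound (C := Real.cosh (R / β))
    (Continuous.comp_aestronglyMeasurable (g := fun x : B => Real.cosh (‖x‖ / β))
      (by fun_prop) hf) ?_
  filter_upwards [hR] with ω hω
  rw [Real.norm_of_nonneg (Real.cosh_pos _).le]
  refine Real.cosh_le_cosh.2 ?_
  have : 0 ≤ ‖f ω‖ := norm_nonneg _
  rw [abs_of_nonneg (by positivity), abs_of_nonneg (div_nonneg (this.trans hω) hβ.le)]
  gcongr

end Sums

variable {B : Type*} [NormedAddCommGroup B] [NormedSpace ℝ B] [CompleteSpace B] {β q : ℝ}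

/-- The one-step estimate for the hyperbolic cosine of the norm of a martingale. -/
theorem IsSmoothSpace.condExp_cosh_norm_add_le [IsFiniteMeasure P] (hB : IsSmoothSpace B β)
    {m : MeasurableSpace Ω} (hm : m ≤ mΩ) {S d : Ω → B} {R : ℝ} (hS : StronglyMeasurable[m] S)
    (hd : StronglyMeasurable[mΩ] d) (hSR : ∀ᵐ ω ∂P, ‖S ω‖ ≤ R) (hd2 : ∀ᵐ ω ∂P, ‖d ω‖ ≤ 2)
    (hmean : P[d | m] =ᵐ[P] 0) (hq : ∀ᵐ ω ∂P, (P[fun ω' => ‖d ω'‖ ^ 2 | m]) ω ≤ q) :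
    ∀ᵐ ω ∂P, (P[fun ω' => Real.cosh (‖S ω' + d ω'‖ / β) | m]) ω ≤
      Real.cosh (‖S ω‖ / β) * (1 + 2 * expQuotient β⁻¹ * q) := by
  obtain ⟨c, g, hc, hg, hA, hcosh⟩ := hB.exists_cosh_norm_add_le
  have hβ := hB.pos
  have hψ := half_le_expQuotient (inv_pos.2 hβ)
  have hdint : Integrable d P := Integrable.of_bound hd.aestronglyMeasurable 2 hd2
  have hd2int : Integrable (fun ω => ‖d ω‖ ^ 2) P := by
    refine Integrable.of_bound (hd.norm.pow 2).aestronglyMeasurable (2 ^ 2) ?_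
    filter_upwards [hd2] with ω hω
    rw [norm_pow, norm_norm]
    gcongr
  have hCm : StronglyMeasurable[m] fun ω => Real.cosh (‖S ω‖ / β) :=
    Continuous.comp_stronglyMeasurable (g := fun x : B => Real.cosh (‖x‖ / β)) (by fun_prop) hS
  have hCint := integrable_cosh_norm_div hβ (hS.mono hm).aestronglyMeasurable hSR
  have hAm : StronglyMeasurable[m] fun ω => c ‖S ω‖ • g (S ω) :=
    (hc.comp hS.norm.measurable).stronglyMeasurable.smul (hg.comp_stronglyMeasurable hS)
  have hAbdd : ∀ᵐ ω ∂P, ‖c ‖S ω‖ • g (S ω)‖ ≤ Real.sinh (R / β) / β := by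
    filter_upwards [hSR] with ω hω
    refine (hA _).trans ?_
    gcongr
    exact Real.sinh_le_sinh.2 (by gcongr)
  -- The linear coefficient is bounded and `m`-measurable, so it leaves the conditional expectation
  -- and meets the zero conditional mean of `d`.
  have e2 := condExp_stronglyMeasurable_bilin_of_bound (ContinuousLinearMap.id ℝ (StrongDual ℝ B))
    hm hAm hdint _ hAbdd
  have hlin : Integrable (fun ω => (c ‖S ω‖ • g (S ω)) (d ω)) P :=
    (ContinuousLinearMap.id ℝ (StrongDual ℝ B)).integrable_of_bilin_of_bdd_left _
      (hAm.mono hm).aestronglyMeasurable hAbdd hdint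
  have hquadbdd : ∀ᵐ ω ∂P, ‖Real.cosh (‖S ω‖ / β)‖ ≤ Real.cosh (R / β) := by
    filter_upwards [hSR] with ω hω
    have := norm_nonneg (S ω)
    rw [Real.norm_of_nonneg (Real.cosh_pos _).le, Real.cosh_le_cosh,
      abs_of_nonneg (by positivity), abs_of_nonneg (div_nonneg (this.trans hω) hβ.le)]
    gcongr
  have hquad : Integrable (fun ω => Real.cosh (‖S ω‖ / β) *
      (2 * expQuotient β⁻¹ * ‖d ω‖ ^ 2)) P :=
    (hd2int.const_mul _).bdd_mul (hCm.mono hm).aestronglyMeasurable hquadbdd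
  have e3 := condExp_mul_of_stronglyMeasurable_left hCm hquad (hd2int.const_mul _)
  have e4 := condExp_smul (μ := P) (2 * expQuotient β⁻¹) (fun ω => ‖d ω‖ ^ 2) m
  have hSd : Integrable (fun ω => Real.cosh (‖S ω + d ω‖ / β)) P := by
    refine integrable_cosh_norm_div hβ ((hS.mono hm).add hd).aestronglyMeasurable (R := R + 2) ?_
    filter_upwards [hSR, hd2] with ω h1 h2
    exact (norm_add_le _ _).trans (add_le_add h1 h2)
  have hle : P[fun ω => Real.cosh (‖S ω + d ω‖ / β) | m] ≤ᵐ[P]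
      P[((fun ω => Real.cosh (‖S ω‖ / β)) + fun ω => (c ‖S ω‖ • g (S ω)) (d ω)) +
        fun ω => Real.cosh (‖S ω‖ / β) * (2 * expQuotient β⁻¹ * ‖d ω‖ ^ 2) | m] := by
    refine condExp_mono hSd ((hCint.add hlin).add hquad) ?_
    filter_upwards [hd2] with ω hω
    exact hcosh (S ω) (d ω) hω
  have e5 := condExp_add (hCint.add hlin) hquad m
  have e6 := condExp_add hCint hlin m
  have e1 := condExp_of_stronglyMeasurable hm hCm hCint
  filter_upwards [hle, e2, e3, e4, e5, e6, hmean, hq] with ω h h2 h3 h4 h5 h6 h7 h8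
  rw [h5, Pi.add_apply, h6, Pi.add_apply, e1] at h
  refine h.trans ?_
  have h2' : (P[fun ω => (c ‖S ω‖ • g (S ω)) (d ω) | m]) ω = 0 := by
    refine Eq.trans h2 ?_
    rw [h7]; simp
  have h3' : (P[fun ω => Real.cosh (‖S ω‖ / β) * (2 * expQuotient β⁻¹ * ‖d ω‖ ^ 2) | m]) ω =
      Real.cosh (‖S ω‖ / β) * (2 * expQuotient β⁻¹ * (P[fun ω => ‖d ω‖ ^ 2 | m]) ω) := by
    refine Eq.trans h3 ?_
    rw [Pi.mul_apply]
    congr 1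
  rw [h2', h3', add_zero, mul_add, mul_one]
  have := (Real.cosh_pos (‖S ω‖ / β)).le
  gcongr

/-- A time-uniform Pinelis inequality in smooth spaces. -/
theorem IsSmoothSpace.measure_exists_lt_norm_sum_le [IsProbabilityMeasure P]
    (hB : IsSmoothSpace B β) {d : ℕ → Ω → B} {δ : ℝ}
    (hd : ∀ n, StronglyMeasurable[ℱ (n + 1)] (d n)) (hbdd : ∀ n, ∀ᵐ ω ∂P, ‖d n ω‖ ≤ 2)
    (hmean : ∀ n, P[d n | ℱ n] =ᵐ[P] 0)
    (hq : ∀ n, ∀ᵐ ω ∂P, (P[fun ω' => ‖d n ω'‖ ^ 2 | ℱ n]) ω ≤ q) (hδ : 0 < δ) :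
    P {ω | ∃ n : ℕ, β * (2 * expQuotient β⁻¹ * q * n + Real.log (2 / δ)) <
      ‖∑ i ∈ Finset.range n, d i ω‖} ≤ ENNReal.ofReal δ := by
  have hβ := hB.pos
  set κ := 2 * expQuotient β⁻¹ * q with hκ
  set S : ℕ → Ω → B := fun n ω => ∑ i ∈ Finset.range n, d i ω with hS
  -- The discount `exp (-κ n)` pays for the one-step factor `1 + κ ≤ exp κ`.
  set Z : ℕ → Ω → ℝ := fun n ω => Real.exp (-(κ * n)) * Real.cosh (‖S n ω‖ / β) with hZdef
  have hSm := stronglyMeasurable_sum_range hd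
  have hSR := ae_norm_sum_range_le hbdd
  have hZ : Supermartingale Z ℱ P := by
    refine supermartingale_nat (fun n => ?_) (fun n => ?_) (fun n => ?_)
    · exact (Continuous.comp_stronglyMeasurable (g := fun x : B => Real.cosh (‖x‖ / β))
        (by fun_prop) (hSm n)).const_mul _
    · exact (integrable_cosh_norm_div hβ ((hSm n).mono (ℱ.le n)).aestronglyMeasurable
        (hSR n)).const_mul _
    · have h1 := hB.condExp_cosh_norm_add_le (ℱ.le n) (hSm n) ((hd n).mono (ℱ.le _)) (hSR n)
        (hbdd n) (hmean n) (hq n)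
      have h2 := condExp_smul (μ := P) (Real.exp (-(κ * (n + 1 : ℕ))))
        (fun ω => Real.cosh (‖S n ω + d n ω‖ / β)) (ℱ n)
      have h3 : Z (n + 1) = Real.exp (-(κ * (n + 1 : ℕ))) •
          fun ω => Real.cosh (‖S n ω + d n ω‖ / β) := by
        ext ω
        simp [hZdef, hS, Finset.sum_range_succ]
      rw [h3]
      filter_upwards [h1, h2] with ω h1 h2
      rw [h2, Pi.smul_apply, smul_eq_mul]
      have h4 : 1 + κ ≤ Real.exp κ := by linarith [Real.add_one_le_exp κ]
      have h5 : Real.exp (-(κ * n)) = Real.exp (-(κ * (n + 1 : ℕ))) * Real.exp κ := by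
        rw [← Real.exp_add]; push_cast; ring_nf
      calc _ ≤ Real.exp (-(κ * (n + 1 : ℕ))) * (Real.cosh (‖S n ω‖ / β) * (1 + κ)) := by
            gcongr
        _ ≤ Real.exp (-(κ * (n + 1 : ℕ))) * (Real.cosh (‖S n ω‖ / β) * Real.exp κ) := by
            have := (Real.cosh_pos (‖S n ω‖ / β)).le
            gcongr
        _ = Z n ω := by simp only [hZdef]; rw [h5]; ring
  have hZ0 : ∀ n ω, 0 ≤ Z n ω := fun n ω =>
    mul_nonneg (Real.exp_pos _).le (Real.cosh_pos _).le
  have hV := measure_exists_le_of_supermartingale hZ hZ0 (inv_pos.2 hδ)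
  have h1 : ∫ ω, Z 0 ω ∂P = 1 := by simp [hZdef, hS]
  rw [h1, one_div, inv_inv] at hV
  refine (measure_mono ?_).trans hV
  rintro ω ⟨n, hn⟩
  refine ⟨n, ?_⟩
  have h2 : κ * n + Real.log (2 / δ) < ‖S n ω‖ / β := by
    rw [lt_div_iff₀ hβ]; linarith
  have h3 := (Real.exp_lt_exp.2 h2).le
  rw [Real.exp_add, Real.exp_log (by positivity)] at h3
  -- Bounding `cosh` below by half an exponential is the source of the 2 in `log (2 / δ)`.
  have h4 : Real.exp (‖S n ω‖ / β) / 2 ≤ Real.cosh (‖S n ω‖ / β) := by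
    rw [Real.cosh_eq]; linarith [Real.exp_pos (-(‖S n ω‖ / β))]
  simp only [hZdef]
  rw [Real.exp_neg, ← div_eq_inv_mul, le_div_iff₀ (Real.exp_pos _)]
  calc δ⁻¹ * Real.exp (κ * n) = Real.exp (κ * n) * (2 / δ) / 2 := by field_simp
    _ ≤ _ := by linarith

end Martingale

/-! ### Pointwise bounds for truncation -/

section Truncation

variable {B : Type*} [NormedAddCommGroup B]

/-- This form has no case distinction at `0` and is visibly continuous. -/
theorem truncWeight_eq (x : B) : truncWeight x = (max 1 ‖x‖)⁻¹ := by
  unfold truncWeight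
  split_ifs with h
  · simp [h]
  · have hx : 0 < ‖x‖ := norm_pos_iff.2 h
    rcases le_total 1 ‖x‖ with h1 | h1
    · rw [min_eq_left h1, max_eq_right h1, one_div]
    · rw [min_eq_right h1, max_eq_left h1, div_self hx.ne', inv_one]

theorem continuous_truncWeight : Continuous (truncWeight : B → ℝ) := by
  have : (truncWeight : B → ℝ) = fun x => (max 1 ‖x‖)⁻¹ := funext truncWeight_eq
  rw [this]
  exact (continuous_const.max continuous_norm).inv₀ fun x => by positivity

variable [NormedSpace ℝ B]

theorem norm_truncWeight_smul (x : B) : ‖truncWeight x • x‖ = min 1 ‖x‖ := by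
  rw [norm_smul, truncWeight_eq, Real.norm_of_nonneg (by positivity)]
  rcases le_total 1 ‖x‖ with h1 | h1
  · rw [min_eq_left h1, max_eq_right h1, inv_mul_cancel₀ (by linarith)]
  · rw [min_eq_right h1, max_eq_left h1, inv_one, one_mul]

theorem norm_truncWeight_smul_sq_le {p : ℝ} (hp0 : 0 ≤ p) (hp : p ≤ 2) (x : B) :
    ‖truncWeight x • x‖ ^ 2 ≤ ‖x‖ ^ p := by
  rw [norm_truncWeight_smul]
  rcases le_total 1 ‖x‖ with h1 | h1
  · rw [min_eq_left h1, one_pow]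
    exact Real.one_le_rpow h1 hp0
  · rw [min_eq_right h1]
    rcases (norm_nonneg x).eq_or_lt with h | h
    · rw [← h]
      simpa using Real.rpow_nonneg le_rfl p
    · rw [← Real.rpow_natCast]
      exact Real.rpow_le_rpow_of_exponent_ge h h1 (by simpa using hp)

theorem truncConst_pos {p : ℝ} (hp : 1 < p) : 0 < truncConst p := by
  have : 0 < p - 1 := by linarith
  unfold truncConst
  positivity

/-- Bernoulli's inequality `1 + p * (u - 1) ≤ u ^ p` at `u = t * (p - 1) / p`. Equality holds at `u
= 1`, so `truncConst p` is the best constant. -/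
theorem sub_one_le_truncConst_mul {p t : ℝ} (hp : 1 < p) (ht : 0 ≤ t) :
    t - 1 ≤ truncConst p * t ^ p := by
  have hp1 : 0 < p - 1 := by linarith
  have hp0 : 0 < p := by linarith
  set u := t * ((p - 1) / p) with hu
  have hu0 : 0 ≤ u := by positivity
  have h1 := one_add_mul_self_le_rpow_one_add (s := u - 1) (by linarith) hp.le
  rw [add_sub_cancel, hu, Real.mul_rpow ht (by positivity)] at h1
  have h2 : ((p - 1) / p) ^ p = (p - 1) * truncConst p := by
    unfold truncConst
    rw [Real.rpow_sub (by positivity), Real.rpow_one]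
    field_simp
  rw [h2] at h1
  have h3 : 1 + p * (t * ((p - 1) / p) - 1) = (p - 1) * (t - 1) := by field_simp; ring
  rw [h3] at h1
  exact le_of_mul_le_mul_left (by linarith) hp1

theorem norm_truncWeight_smul_sub_le {p : ℝ} (hp : 1 < p) (x : B) :
    ‖truncWeight x • x - x‖ ≤ truncConst p * ‖x‖ ^ p := by
  have hK := (truncConst_pos hp).le
  have e : truncWeight x • x - x = (truncWeight x - 1) • x := by rw [sub_smul, one_smul]
  rw [e, norm_smul, truncWeight_eq]
  rcases le_total 1 ‖x‖ with h1 | h1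
  · rw [max_eq_right h1, Real.norm_of_nonpos (by linarith [inv_le_one_of_one_le₀ h1])]
    have h0 : ‖x‖ ≠ 0 := by linarith
    have := sub_one_le_truncConst_mul hp (norm_nonneg x)
    rw [neg_sub, sub_mul, inv_mul_cancel₀ h0, one_mul]
    exact this
  · rw [max_eq_left h1]
    simp only [inv_one, sub_self, norm_zero, zero_mul]
    positivity

end Truncation

/-! ### Second moments after conditional centering -/

section Centering

variable {Ω B : Type*} {m mΩ : MeasurableSpace Ω} {P : Measure Ω} [IsProbabilityMeasure P]
  [NormedAddCommGroup B] [NormedSpace ℝ B] [CompleteSpace B]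

omit [NormedSpace ℝ B] [CompleteSpace B] in
theorem integrable_norm_sq_of_bound {W : Ω → B} {R : ℝ} (hW : AEStronglyMeasurable W P)
    (hR : ∀ᵐ ω ∂P, ‖W ω‖ ≤ R) : Integrable (fun ω => ‖W ω‖ ^ 2) P := by
  refine Integrable.of_bound (hW.norm.pow 2) (R ^ 2) ?_
  filter_upwards [hR] with ω hω
  rw [norm_pow, norm_norm]
  gcongr

omit [IsProbabilityMeasure P] in
theorem ae_norm_condExp_sq_le {W : Ω → B} (hint : Integrable (fun ω => ‖W ω‖ ^ 2) P) :
    ∀ᵐ ω ∂P, ‖(P[W | m]) ω‖ ^ 2 ≤ (P[fun ω' => ‖W ω'‖ ^ 2 | m]) ω := by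
  have := Integrable.norm_condExp_rpow_le (m := m) (μ := P) (f := W) (p := 2) (by norm_num)
    (by simpa using hint)
  simpa [Filter.EventuallyLE] using this

/-- The triangle inequality gives `‖W - M‖ ^ 2 ≤ 2 * ‖W‖ ^ 2 + 2 * ‖M‖ ^ 2`, and conditional Jensen
bounds `‖M‖ ^ 2` by the conditional second moment of `W`. -/
theorem condExp_norm_sub_sq_le (hm : m ≤ mΩ) {W : Ω → B} {R : ℝ}
    (hW : AEStronglyMeasurable W P) (hR : ∀ᵐ ω ∂P, ‖W ω‖ ≤ R) :
    ∀ᵐ ω ∂P, (P[fun ω' => ‖W ω' - (P[W | m]) ω'‖ ^ 2 | m]) ω ≤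
      4 * (P[fun ω' => ‖W ω'‖ ^ 2 | m]) ω := by
  set M := P[W | m] with hM
  have hMm : StronglyMeasurable[m] M := stronglyMeasurable_condExp
  have hMR : ∀ᵐ ω ∂P, ‖M ω‖ ≤ R := ae_bdd_norm_condExp_of_ae_bdd_norm hR
  have hWint := integrable_norm_sq_of_bound hW hR
  have hMint := integrable_norm_sq_of_bound (hMm.mono hm).aestronglyMeasurable hMR
  have hdint : Integrable (fun ω => ‖W ω - M ω‖ ^ 2) P := by
    refine integrable_norm_sq_of_bound (R := R + R)
      (hW.sub (hMm.mono hm).aestronglyMeasurable) ?_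
    filter_upwards [hR, hMR] with ω h1 h2
    exact (norm_sub_le _ _).trans (add_le_add h1 h2)
  have hle : P[fun ω => ‖W ω - M ω‖ ^ 2 | m] ≤ᵐ[P]
      P[(2 : ℝ) • (fun ω => ‖W ω‖ ^ 2) + (2 : ℝ) • fun ω => ‖M ω‖ ^ 2 | m] := by
    refine condExp_mono hdint ((hWint.smul (2 : ℝ)).add (hMint.smul (2 : ℝ))) ?_
    filter_upwards with ω
    simp only [Pi.add_apply, Pi.smul_apply, smul_eq_mul]
    have := norm_sub_le (W ω) (M ω)
    nlinarith [norm_nonneg (W ω - M ω), sq_nonneg (‖W ω‖ - ‖M ω‖)]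
  have e1 := condExp_add (hWint.smul (2 : ℝ)) (hMint.smul (2 : ℝ)) m
  have e2 := condExp_smul (μ := P) (2 : ℝ) (fun ω => ‖W ω‖ ^ 2) m
  have e3 := condExp_smul (μ := P) (2 : ℝ) (fun ω => ‖M ω‖ ^ 2) m
  have e4 := condExp_of_stronglyMeasurable hm (hMm.norm.pow 2) hMint
  filter_upwards [hle, e1, e2, e3, ae_norm_condExp_sq_le (m := m) hWint] with ω h h1 h2 h3 h4
  have h5 : (P[fun ω => ‖M ω‖ ^ 2 | m]) ω = ‖M ω‖ ^ 2 := congrFun e4 ω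
  rw [h1, Pi.add_apply, h2, h3, Pi.smul_apply, Pi.smul_apply, smul_eq_mul, smul_eq_mul, h5] at h
  linarith

/-- The inner product inducing the norm, as a continuous bilinear map. -/
theorem NormIsInner.exists_continuous {B : Type*} [NormedAddCommGroup B] [NormedSpace ℝ B]
    (h : NormIsInner B) :
    ∃ ip : B →L[ℝ] B →L[ℝ] ℝ, (∀ x, ip x x = ‖x‖ ^ 2) ∧
      ∀ x y, ‖y - x‖ ^ 2 = ‖y‖ ^ 2 - 2 * ip x y + ‖x‖ ^ 2 := by
  obtain ⟨ip, hsymm, hip⟩ := h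
  have hsub : ∀ x y, ‖y - x‖ ^ 2 = ‖y‖ ^ 2 - 2 * ip x y + ‖x‖ ^ 2 := by
    intro x y
    rw [← hip, ← hip, ← hip, map_sub, map_sub, LinearMap.sub_apply, LinearMap.sub_apply,
      hsymm y x]
    ring
  -- Boundedness comes from polarization and the triangle inequality; the value 2 is not sharp, but
  -- any constant gives continuity.
  refine ⟨LinearMap.mkContinuous₂ ip 2 fun x y => ?_, fun x => hip x, fun x y => hsub x y⟩
  have h1 := hsub x y
  have h2 := norm_sub_norm_le y x
  have h3 := norm_sub_norm_le x y
  rw [norm_sub_rev x y] at h3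
  have h4 := norm_sub_le y x
  have hx := norm_nonneg x
  have hy := norm_nonneg y
  rw [Real.norm_eq_abs, abs_le]
  constructor <;> nlinarith [norm_nonneg (y - x), mul_nonneg hx hy]

/-- With an inner product, expanding the square gives the conditional second moment of `W` minus
`‖M‖ ^ 2`, so centering costs nothing. -/
theorem NormIsInner.condExp_norm_sub_sq_le (hB : NormIsInner B) (hm : m ≤ mΩ) {W : Ω → B} {R : ℝ}
    (hW : AEStronglyMeasurable W P) (hR : ∀ᵐ ω ∂P, ‖W ω‖ ≤ R) :
    ∀ᵐ ω ∂P, (P[fun ω' => ‖W ω' - (P[W | m]) ω'‖ ^ 2 | m]) ω ≤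
      (P[fun ω' => ‖W ω'‖ ^ 2 | m]) ω := by
  obtain ⟨ip, hip, hsub⟩ := hB.exists_continuous
  set M := P[W | m] with hM
  have hMm : StronglyMeasurable[m] M := stronglyMeasurable_condExp
  have hMR : ∀ᵐ ω ∂P, ‖M ω‖ ≤ R := ae_bdd_norm_condExp_of_ae_bdd_norm hR
  have hWi : Integrable W P := Integrable.of_bound hW R hR
  have hWint := integrable_norm_sq_of_bound hW hR
  have hMint := integrable_norm_sq_of_bound (hMm.mono hm).aestronglyMeasurable hMR
  have hipint : Integrable (fun ω => ip (M ω) (W ω)) P :=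
    ip.integrable_of_bilin_of_bdd_left R (hMm.mono hm).aestronglyMeasurable hMR hWi
  have heq : (fun ω => ‖W ω - M ω‖ ^ 2) =
      ((fun ω => ‖W ω‖ ^ 2) - (2 : ℝ) • fun ω => ip (M ω) (W ω)) + fun ω => ‖M ω‖ ^ 2 := by
    ext ω
    simp [hsub]
  rw [heq]
  have e1 := condExp_add (hWint.sub (hipint.smul (2 : ℝ))) hMint m
  have e2 := condExp_sub hWint (hipint.smul (2 : ℝ)) m
  have e3 := condExp_smul (μ := P) (2 : ℝ) (fun ω => ip (M ω) (W ω)) m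
  have e4 := condExp_of_stronglyMeasurable hm (hMm.norm.pow 2) hMint
  have e5 := condExp_stronglyMeasurable_bilin_of_bound ip hm hMm hWi R hMR
  filter_upwards [e1, e2, e3, e5] with ω h1 h2 h3 h4
  have h5 : (P[fun ω => ‖M ω‖ ^ 2 | m]) ω = ‖M ω‖ ^ 2 := congrFun e4 ω
  rw [h1, Pi.add_apply, h2, Pi.sub_apply, h3, Pi.smul_apply, smul_eq_mul, h4, h5, ← hM, hip]
  nlinarith [sq_nonneg ‖M ω‖]

end Centering

/-! ### The truncated mean: bias, fluctuation and the time-uniform bound -/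

section TruncatedMean

variable {Ω B : Type*} {mΩ : MeasurableSpace Ω} {P : Measure Ω} [IsProbabilityMeasure P]
  [NormedAddCommGroup B] [NormedSpace ℝ B] [CompleteSpace B]

open Classical in
/-- The factor of `spaceConst` that bounds the cost of centering a truncated variable. -/
noncomputable def centeringConst (B : Type*) [NormedAddCommGroup B] [NormedSpace ℝ B]
    (p : ℝ) : ℝ := if NormIsInner B then 2 ^ (p - 1) else 2 ^ (p + 1)

omit [CompleteSpace B] in
theorem spaceConst_eq (p β : ℝ) :
    spaceConst B p β = centeringConst B p * expQuotient β⁻¹ := by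
  unfold spaceConst spaceConstAt centeringConst expQuotient
  split_ifs <;> rfl

omit [CompleteSpace B] in
theorem centeringConst_pos (p : ℝ) : 0 < centeringConst B p := by
  unfold centeringConst
  split_ifs <;> positivity

/-- The factors actually obtained, 1 and 4, are at most `2 ^ (p - 1)` and `2 ^ (p + 1)` since `1 ≤
p`. -/
theorem condExp_norm_sub_sq_le_centeringConst {m : MeasurableSpace Ω} (hm : m ≤ mΩ) {p : ℝ}
    (hp : 1 ≤ p) {W : Ω → B} {R : ℝ} (hW : AEStronglyMeasurable[mΩ] W P)
    (hR : ∀ᵐ ω ∂P, ‖W ω‖ ≤ R) :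
    ∀ᵐ ω ∂P, (P[fun ω' => ‖W ω' - (P[W | m]) ω'‖ ^ 2 | m]) ω ≤
      centeringConst B p * (P[fun ω' => ‖W ω'‖ ^ 2 | m]) ω := by
  have h0 : 0 ≤ᵐ[P] P[fun ω' => ‖W ω'‖ ^ 2 | m] :=
    condExp_nonneg (Filter.Eventually.of_forall fun ω => sq_nonneg ‖W ω‖)
  by_cases hB : NormIsInner B
  · filter_upwards [h0, hB.condExp_norm_sub_sq_le hm hW hR] with ω h1 h2
    refine h2.trans (le_mul_of_one_le_left h1 ?_)
    rw [centeringConst, if_pos hB]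
    exact Real.one_le_rpow (by norm_num) (by linarith)
  · filter_upwards [h0, condExp_norm_sub_sq_le hm hW hR] with ω h1 h2
    refine h2.trans (mul_le_mul_of_nonneg_right ?_ h1)
    rw [centeringConst, if_neg hB]
    calc (4 : ℝ) = 2 ^ (2 : ℝ) := by norm_num
      _ ≤ 2 ^ (p + 1) := Real.rpow_le_rpow_of_exponent_le (by norm_num) (by linarith)

theorem one_sub_le_measureReal_of_ae {A S : Set Ω} {δ : ℝ} (hδ : 0 ≤ δ)
    (hA : P A ≤ ENNReal.ofReal δ) (h : ∀ᵐ ω ∂P, ω ∉ A → ω ∈ S) : 1 - δ ≤ P.real S := by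
  have h1 : P.real Sᶜ ≤ δ := by
    refine ENNReal.toReal_le_of_le_ofReal hδ (le_trans (measure_mono_ae ?_) hA)
    filter_upwards [h] with ω hω hS
    by_contra hA
    exact hS (hω hA)
  have h2 : P.real Set.univ ≤ P.real S + P.real Sᶜ := by
    rw [← Set.union_compl_self S]
    exact measureReal_union_le _ _
  rw [probReal_univ] at h2
  linarith

variable {ℱ : Filtration ℕ mΩ} {X : ℕ → Ω → B} {mu : B} {β p v lam : ℝ}

/-- The rescaled truncated increments, indexed from zero. -/
noncomputable def truncIncrement (X : ℕ → Ω → B) (lam : ℝ) (n : ℕ) (ω : Ω) : B :=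
  truncWeight (lam • X (n + 1) ω) • (lam • X (n + 1) ω)

omit [CompleteSpace B] in
theorem norm_truncIncrement_le (n : ℕ) (ω : Ω) : ‖truncIncrement X lam n ω‖ ≤ 1 := by
  rw [truncIncrement, norm_truncWeight_smul]
  exact min_le_left _ _

omit [CompleteSpace B] in
theorem smul_truncMean {n : ℕ} (hn : 1 ≤ n) (ω : Ω) :
    (lam * n) • truncMean (fun m => X m ω) lam n =
      ∑ i ∈ Finset.range n, truncIncrement X lam i ω := by
  have hn' : (n : ℝ) ≠ 0 := by positivity
  have h1 : ∑ m ∈ Finset.Icc 1 n, truncWeight (lam • X m ω) • X m ω =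
      ∑ i ∈ Finset.range n, truncWeight (lam • X (i + 1) ω) • X (i + 1) ω := by
    clear hn hn'
    induction n with
    | zero => simp
    | succ n ih => rw [Finset.sum_Icc_succ_top (by omega), Finset.sum_range_succ, ih]
  rw [truncMean, smul_smul, h1, mul_assoc, mul_one_div_cancel hn', mul_one, Finset.smul_sum]
  refine Finset.sum_congr rfl fun i _ => ?_
  rw [truncIncrement, smul_comm]

namespace RawMomentProcess

omit [IsProbabilityMeasure P] in
theorem stronglyMeasurable_truncIncrement (hX : RawMomentProcess P ℱ X mu p v) (n : ℕ) :
    StronglyMeasurable[ℱ (n + 1)] (truncIncrement X lam n) :=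
  Continuous.comp_stronglyMeasurable (g := fun x : B => truncWeight (lam • x) • (lam • x))
    ((continuous_truncWeight.comp (continuous_const_smul lam)).smul (continuous_const_smul lam))
    (hX.adapted (n + 1) (by omega))

theorem integrable_truncIncrement (hX : RawMomentProcess P ℱ X mu p v) (n : ℕ) :
    Integrable (truncIncrement X lam n) P :=
  Integrable.of_bound
    ((hX.stronglyMeasurable_truncIncrement n).mono (ℱ.le _)).aestronglyMeasurable 1
    (Filter.Eventually.of_forall fun ω => norm_truncIncrement_le n ω)

omit [IsProbabilityMeasure P] in
theorem ae_condExp_norm_smul_rpow_le (hX : RawMomentProcess P ℱ X mu p v) (hlam : 0 < lam)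
    {c : ℝ} (hc : 0 ≤ c) {f : Ω → ℝ} (hf : Integrable f P) (n : ℕ)
    (hle : ∀ ω, f ω ≤ c * ‖lam • X (n + 1) ω‖ ^ p) :
    ∀ᵐ ω ∂P, (P[f | ℱ n]) ω ≤ c * lam ^ p * v := by
  have hmono : P[f | ℱ n] ≤ᵐ[P] P[(c * lam ^ p) • fun ω => ‖X (n + 1) ω‖ ^ p | ℱ n] := by
    refine condExp_mono hf ((hX.integrable_moment (n + 1) (by omega)).smul _)
      (Filter.Eventually.of_forall fun ω => (hle ω).trans_eq ?_)
    rw [norm_smul, Real.norm_of_nonneg hlam.le, Real.mul_rpow hlam.le (norm_nonneg _)]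
    simp [mul_assoc]
  have e := condExp_smul (μ := P) (c * lam ^ p) (fun ω => ‖X (n + 1) ω‖ ^ p) (ℱ n)
  have hv := hX.cond_moment (n + 1) (by omega)
  rw [add_tsub_cancel_right] at hv
  filter_upwards [hmono, e, hv] with ω h1 h2 h3
  rw [h2, Pi.smul_apply, smul_eq_mul] at h1
  exact h1.trans (by gcongr)

theorem ae_condExp_norm_truncIncrement_sq_le (hX : RawMomentProcess P ℱ X mu p v) (hp0 : 0 ≤ p)
    (hp : p ≤ 2) (hlam : 0 < lam) (n : ℕ) :
    ∀ᵐ ω ∂P, (P[fun ω' => ‖truncIncrement X lam n ω'‖ ^ 2 | ℱ n]) ω ≤ lam ^ p * v := by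
  have hint := integrable_norm_sq_of_bound (P := P)
    (hX.integrable_truncIncrement (lam := lam) n).aestronglyMeasurable
    (Filter.Eventually.of_forall fun ω => norm_truncIncrement_le n ω)
  have := hX.ae_condExp_norm_smul_rpow_le hlam zero_le_one hint n fun ω => by
    rw [one_mul]
    exact norm_truncWeight_smul_sq_le hp0 hp _
  simpa using this

/-- The bias is the conditional mean of `W - lam • X`, whose norm is pointwise at most `K_p * ‖lam •
X‖ ^ p`. -/
theorem ae_norm_condExp_truncIncrement_sub_le (hX : RawMomentProcess P ℱ X mu p v) (hp : 1 < p)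
    (hlam : 0 < lam) (n : ℕ) :
    ∀ᵐ ω ∂P, ‖(P[truncIncrement X lam n | ℱ n]) ω - lam • mu‖ ≤
      truncConst p * lam ^ p * v := by
  have hXi : Integrable (lam • X (n + 1)) P := (hX.integrable (n + 1) (by omega)).smul lam
  have hW := hX.integrable_truncIncrement (lam := lam) n
  have e1 := condExp_sub hW hXi (ℱ n)
  have e2 := condExp_smul (μ := P) lam (X (n + 1)) (ℱ n)
  have e3 := hX.cond_mean (n + 1) (by omega)
  rw [add_tsub_cancel_right] at e3
  have h1 := norm_condExp_le (μ := P) (m := ℱ n) (truncIncrement X lam n - lam • X (n + 1))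
  have h2 := hX.ae_condExp_norm_smul_rpow_le hlam (truncConst_pos hp).le
    (hW.sub hXi).norm n fun ω => norm_truncWeight_smul_sub_le hp _
  filter_upwards [e1, e2, e3, h1, h2] with ω e1 e2 e3 h1 h2
  rw [e1, Pi.sub_apply, e2, Pi.smul_apply, e3] at h1
  exact h1.trans h2

theorem one_sub_le_measureReal_norm_truncMean_sub_le (hX : RawMomentProcess P ℱ X mu p v)
    (hB : IsSmoothSpace B β) (hp : p ∈ Set.Ioc (1 : ℝ) 2) (hv : 0 < v) {δ : ℝ} (hδ : 0 < δ)
    (hlam : 0 < lam) :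
    1 - δ ≤ P.real {ω | ∀ n : ℕ, 1 ≤ n →
      ‖truncMean (fun m => X m ω) lam n - mu‖ ≤
        2 * v * lam ^ (p - 1) * (β * spaceConst B p β + truncConst p * 2 ^ (p - 1))
          + β * Real.log (2 / δ) / (lam * n)} := by
  have hβ := hB.pos
  have hK := truncConst_pos hp.1
  set W : ℕ → Ω → B := truncIncrement X lam with hW
  set M : ℕ → Ω → B := fun n => P[W n | ℱ n] with hM
  set q := centeringConst B p * (lam ^ p * v) with hq
  have hWint : ∀ n, Integrable (W n) P := hX.integrable_truncIncrement
  have hWbdd : ∀ n, ∀ᵐ ω ∂P, ‖W n ω‖ ≤ 1 := fun n =>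
    Filter.Eventually.of_forall fun ω => norm_truncIncrement_le n ω
  have hMm : ∀ n, StronglyMeasurable[ℱ n] (M n) := fun n => stronglyMeasurable_condExp
  have hconc := hB.measure_exists_lt_norm_sum_le (P := P) (ℱ := ℱ) (d := fun n => W n - M n)
    (q := q) (δ := δ)
    (fun n => (hX.stronglyMeasurable_truncIncrement n).sub ((hMm n).mono (ℱ.mono n.le_succ)))
    (fun n => ?_) (fun n => ?_) (fun n => ?_) hδ
  · refine one_sub_le_measureReal_of_ae hδ.le hconc ?_
    filter_upwards [ae_all_iff.2 fun n =>
      hX.ae_norm_condExp_truncIncrement_sub_le hp.1 hlam n] with ω hbias hω n hn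
    simp only [not_exists, not_lt] at hω
    have hn' : (0 : ℝ) < n := by positivity
    have h1 := hω n
    have h2 : ‖∑ i ∈ Finset.range n, (M i ω - lam • mu)‖ ≤ n * (truncConst p * lam ^ p * v) := by
      simpa using norm_sum_le_of_le (Finset.range n) fun i _ => hbias i
    -- Fluctuation plus bias: the first sum is controlled by concentration, the second almost
    -- surely.
    have h3 : (lam * n) • (truncMean (fun m => X m ω) lam n - mu) =
        ∑ i ∈ Finset.range n, (W i - M i) ω + ∑ i ∈ Finset.range n, (M i ω - lam • mu) := by
      rw [smul_sub, smul_truncMean hn, ← Finset.sum_add_distrib]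
      simp only [Pi.sub_apply, sub_add_sub_cancel, Finset.sum_sub_distrib, Finset.sum_const,
        Finset.card_range]
      rw [← Nat.cast_smul_eq_nsmul ℝ, smul_smul, mul_comm lam]
    have h4 := (norm_add_le _ _).trans (add_le_add h1 h2)
    rw [← h3, norm_smul, Real.norm_of_nonneg (by positivity)] at h4
    have h5 : 2 * expQuotient β⁻¹ * q = 2 * spaceConst B p β * (lam ^ p * v) := by
      rw [hq, spaceConst_eq]; ring
    rw [h5] at h4
    have h6 : lam ^ p = lam ^ (p - 1) * lam := by
      rw [← Real.rpow_add_one hlam.ne', sub_add_cancel]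
    have h7 : (1 : ℝ) ≤ 2 ^ (p - 1) := Real.one_le_rpow (by norm_num) (by linarith [hp.1])
    -- The bias appears here with constant `K_p`; the factor `2 * 2 ^ (p - 1)` in the statement is
    -- slack.
    have h8 : truncConst p * lam ^ (p - 1) * v ≤
        2 * v * lam ^ (p - 1) * (truncConst p * 2 ^ (p - 1)) := by
      have : 0 ≤ truncConst p * lam ^ (p - 1) * v := by positivity
      nlinarith
    refine le_of_mul_le_mul_left (h4.trans ?_) (show 0 < lam * n by positivity)
    rw [mul_add (lam * n), mul_div_cancel₀ (b := lam * (n : ℝ)) _ (by positivity), h6]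
    have h9 := mul_le_mul_of_nonneg_left h8 (show 0 ≤ lam * n by positivity)
    linarith
  -- Both `W n` and its conditional mean have norm at most 1, whence the increment bound 2 and the
  -- exponent `2 / β` in the space constant.
  · have hMbdd : ∀ᵐ ω ∂P, ‖M n ω‖ ≤ 1 := ae_bdd_norm_condExp_of_ae_bdd_norm (hWbdd n)
    filter_upwards [hWbdd n, hMbdd] with ω h1 h2
    exact (norm_sub_le _ _).trans (by linarith)
  · have e1 := condExp_sub (hWint n) (integrable_condExp (μ := P) (m := ℱ n) (f := W n)) (ℱ n)
    have e2 : P[M n | ℱ n] = M n :=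
      condExp_of_stronglyMeasurable (ℱ.le n) (hMm n) integrable_condExp
    filter_upwards [e1] with ω h1
    refine h1.trans ?_
    rw [Pi.sub_apply, Pi.zero_apply, sub_eq_zero]
    exact (congrFun e2 ω).symm
  · filter_upwards [condExp_norm_sub_sq_le_centeringConst (ℱ.le n) hp.1.le
      (hWint n).aestronglyMeasurable (hWbdd n),
      hX.ae_condExp_norm_truncIncrement_sq_le (by linarith [hp.1]) hp.2 hlam n] with ω h1 h2
    exact h1.trans (mul_le_mul_of_nonneg_left h2 (centeringConst_pos p).le)

end RawMomentProcess

end TruncatedMean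

/-! ### Choice of the truncation level and the main theorem -/

/-- The value of `A * lam ^ (p - 1) + b / lam` at the level `lam` balancing the two terms. -/
theorem balanced_level_eq {A b p : ℝ} (hA : 0 < A) (hb : 0 < b) (hp : 0 < p) :
    A * ((b / A) ^ (1 / p)) ^ (p - 1) + b / (b / A) ^ (1 / p) =
      2 * A ^ (1 / p) * b ^ ((p - 1) / p) := by
  have e : (p - 1) / p = 1 - 1 / p := by field_simp
  have h1 : A * ((b / A) ^ (1 / p)) ^ (p - 1) = A ^ (1 / p) * b ^ ((p - 1) / p) := by
    rw [← Real.rpow_mul (by positivity), one_div_mul_eq_div, e, Real.div_rpow hb.le hA.le,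
      Real.rpow_sub hA, Real.rpow_one]
    field_simp
  have h2 : b / (b / A) ^ (1 / p) = A ^ (1 / p) * b ^ ((p - 1) / p) := by
    rw [e, Real.div_rpow hb.le hA.le, Real.rpow_sub hb, Real.rpow_one]
    field_simp
  rw [h1, h2]
  ring

theorem mainTheorem8 {Ω B : Type*} {mΩ : MeasurableSpace Ω} [NormedAddCommGroup B]
    [NormedSpace ℝ B] [CompleteSpace B] [TopologicalSpace.SeparableSpace B]
    (P : Measure Ω) [IsProbabilityMeasure P] (ℱ : Filtration ℕ mΩ)
    (X : ℕ → Ω → B) (mu : B) (β p v δ : ℝ)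
    (hB : IsSmoothSpace B β) (hp : p ∈ Set.Ioc (1 : ℝ) 2) (hv : 0 < v)
    (hX : RawMomentProcess P ℱ X mu p v) (hδ : δ ∈ Set.Ioc (0 : ℝ) 1) :
    (∀ lam : ℝ, 0 < lam →
      1 - δ ≤ P.real {ω | ∀ n : ℕ, 1 ≤ n →
        ‖truncMean (fun m => X m ω) lam n - mu‖ ≤
          2 * v * lam ^ (p - 1) * (β * spaceConst B p β + truncConst p * 2 ^ (p - 1))
            + β * Real.log (2 / δ) / (lam * n)}) ∧
    (∀ n : ℕ, 1 ≤ n → ∀ lam : ℝ,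
      lam = (Real.log (2 / δ) * β /
        (2 * n * v * (β * spaceConst B p β + truncConst p * 2 ^ (p - 1)))) ^ (1 / p) →
      1 - δ ≤ P.real {ω |
        ‖truncMean (fun m => X m ω) lam n - mu‖ ≤
          2 * (2 * v * (β * spaceConst B p β + truncConst p * 2 ^ (p - 1))) ^ (1 / p)
            * (β * (Real.log (2 / δ) / n)) ^ ((p - 1) / p)}) := by
  have hβ := hB.pos
  refine ⟨fun lam hlam =>
    hX.one_sub_le_measureReal_norm_truncMean_sub_le hB hp hv hδ.1 hlam, fun n hn lam hlam => ?_⟩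
  have hL : 0 < Real.log (2 / δ) :=
    Real.log_pos ((one_lt_div hδ.1).2 (by linarith [hδ.2]))
  have hn' : (0 : ℝ) < n := by positivity
  have hC : 0 < spaceConst B p β := by
    rw [spaceConst_eq]
    exact mul_pos (centeringConst_pos p)
      (one_half_pos.trans_le (half_le_expQuotient (inv_pos.2 hβ)))
  have hK := truncConst_pos hp.1
  set D := β * spaceConst B p β + truncConst p * 2 ^ (p - 1) with hD
  have hD0 : 0 < D := by positivity
  -- The given level is `(b / A) ^ (1 / p)` with `A = 2 * v * D` and `b = β * log (2 / δ) / n`,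
  -- which equalizes `A * lam ^ (p - 1)` and `b / lam`.
  have hlam' : lam = (β * (Real.log (2 / δ) / n) / (2 * v * D)) ^ (1 / p) := by
    rw [hlam]; congr 1; field_simp
  have hbal := balanced_level_eq (A := 2 * v * D) (b := β * (Real.log (2 / δ) / n)) (p := p)
    (by positivity) (by positivity) (by linarith [hp.1])
  rw [← hlam'] at hbal
  have hlam0 : 0 < lam := by rw [hlam']; positivity
  refine (hX.one_sub_le_measureReal_norm_truncMean_sub_le hB hp hv hδ.1 hlam0).trans
    (measureReal_mono fun ω hω => (hω n hn).trans (le_of_eq ?_))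
  rw [← hD, ← hbal]
  field_simp
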